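/- Let $n\ge 4$, let $x_0<x_1<\dots<x_n$ be real knots, $h:=\max_{1\le i\le n}(x_i-x_{i-1})$, and let $f:[x_0,x_n]\to\mathbb{R}$ be four times continuously differentiable. Put $\|f^{(4)}\|_\infty:=\max_{[x_0,x_n]}|f^{(4)}|$. If $f^{(5)}$ exists and is continuous on each of the intervals $[x_0,x_4]$ and $[x_{n-4},x_n]$ (one-sided derivatives at their end points), let $\|f^{(5)}\|_\infty$ be the maximum of $|f^{(5)}|$ on $[x_0,x_4]\cup[x_{n-4},x_n]$; otherwise let $\|f^{(5)}\|_\infty:=\infty$. Let $p$ and $r$ be the polynomials of degree at most four that interpolate $f$ at $x_0,\dots,x_4$ and at $x_{n-4},\dots,x_n$, respectively. Let $s$ be the Q-spline of $f$, that is, the function $s\in C^2([x_0,x_n])$ that is a polynomial of degree at most three on each $[x_{i-1},x_i]$, $1\le i\le n$, and satisfies $s(x_i)=f(x_i)$ for $0\le i\le n$, $s''(x_0)=p''(x_0)$ and $s''(x_n)=r''(x_n)$. Then, for all $x\in[x_0,x_n]$, $$|s(x)-f(x)|\le\left(\tfrac{5}{384}+\tfrac{R}{8}\right)\|f^{(4)}\|_\infty\,h^4,\qquad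 R=\min\left\{\tfrac{11}{6},\ \frac{5h\,\|f^{(5)}\|_\infty}{12\,\|f^{(4)}\|_\infty}\right\},$$ where the quotient is read as $0$ if $\|f^{(4)}\|_\infty=0$ (in which case also $\|f^{(5)}\|_\infty=0$). -/

import Mathlib

open Set Polynomial
open scoped ENNReal

namespace QSpline

/-- The mesh size `h = max_{1 ≤ i ≤ n} (x_i - x_{i-1})` of the knots `x_0 < ... < x_n`.
Only the values `x 0, ..., x n` of the sequence `x` are used. -/
noncomputable def meshSize (n : ℕ) (x : ℕ → ℝ) : ℝ :=
  ⨆ i : Fin n, (x (i + 1) - x i)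

/-- The maximum of `|f^(k)|` on the interval `[a, b]` (one-sided derivatives at `a` and `b`),
for `f` that is `k` times continuously differentiable on `[a, b]`. -/
noncomputable def derivNorm (k : ℕ) (f : ℝ → ℝ) (a b : ℝ) : ℝ :=
  sSup ((fun t => |iteratedDerivWithin k f (Icc a b) t|) '' Icc a b)

open Classical in
/-- `‖f⁽⁵⁾‖_∞`, with values in `[0, ∞]`: the maximum of `|f⁽⁵⁾|` on
`[x_0, x_4] ∪ [x_{n-4}, x_n]` if `f⁽⁵⁾` exists and is continuous on each of these two
intervals, and `∞` otherwise. -/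
noncomputable def fifthNorm (n : ℕ) (x : ℕ → ℝ) (f : ℝ → ℝ) : ℝ≥0∞ :=
  if ContDiffOn ℝ 5 f (Icc (x 0) (x 4)) ∧ ContDiffOn ℝ 5 f (Icc (x (n - 4)) (x n)) then
    ENNReal.ofReal (max (derivNorm 5 f (x 0) (x 4)) (derivNorm 5 f (x (n - 4)) (x n)))
  else ⊤

/-- `R = min {11/6, 5 h ‖f⁽⁵⁾‖_∞ / (12 ‖f⁽⁴⁾‖_∞)}`, computed in `[0, ∞]` and finite.
If `‖f⁽⁴⁾‖_∞ = 0` then `‖f⁽⁵⁾‖_∞ = 0` and the ratio `0 / 0` is read as `0`, which is its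
value in `ℝ≥0∞`. -/
noncomputable def ratioR (n : ℕ) (x : ℕ → ℝ) (f : ℝ → ℝ) : ℝ :=
  (min (11 / 6) (5 * ENNReal.ofReal (meshSize n x) * fifthNorm n x f /
    (12 * ENNReal.ofReal (derivNorm 4 f (x 0) (x n))))).toReal

/-- The polynomial of degree at most four interpolating `f` at `x_m, ..., x_{m+4}`. -/
noncomputable def quartic (x : ℕ → ℝ) (f : ℝ → ℝ) (m : ℕ) : ℝ[X] :=
  Lagrange.interpolate (Finset.Icc m (m + 4)) x (fun i => f (x i))

/-- `s` is, on `[x_0, x_n]`, a cubic spline with knots `x_0 < ... < x_n`: it is twice continuously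
differentiable there and agrees with a polynomial of degree at most three on each
`[x_i, x_{i+1}]`. -/
structure IsCubicSpline (n : ℕ) (x : ℕ → ℝ) (s : ℝ → ℝ) : Prop where
  contDiffOn : ContDiffOn ℝ 2 s (Icc (x 0) (x n))
  cubic : ∀ i < n, ∃ q : ℝ[X], q.natDegree ≤ 3 ∧ ∀ t ∈ Icc (x i) (x (i + 1)), s t = q.eval t

/-- `s` is the Q-spline of `f`: the cubic spline that interpolates `f` at all knots, with
`s''(x_0) = p''(x_0)` and `s''(x_n) = r''(x_n)`, where `p` and `r` are the quartics that
interpolate `f` at the first five and at the last five knots. -/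
structure IsQSpline (n : ℕ) (x : ℕ → ℝ) (f s : ℝ → ℝ) : Prop where
  isCubicSpline : IsCubicSpline n x s
  interpolates : ∀ i ≤ n, s (x i) = f (x i)
  left_end : iteratedDerivWithin 2 s (Icc (x 0) (x n)) (x 0) =
    (derivative (derivative (quartic x f 0))).eval (x 0)
  right_end : iteratedDerivWithin 2 s (Icc (x 0) (x n)) (x n) =
    (derivative (derivative (quartic x f (n - 4)))).eval (x n)

end QSpline

/-! On one knot interval the error `f - s` is a cubic Hermite remainder, at most `F * h ^ 4 / 384`
(`hermite_bound`), plus the cubic that vanishes at both knots and carries the slope errors `e i` of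
`f' - s'` (`interval_bound`). So everything rests on the slope errors.

`slope_relation` ties the slope errors at the ends of an interval to the second-derivative error at
one end. At an interior knot the two adjacent relations share that second-derivative error;
eliminating it leaves a diagonally dominant recurrence (`interior_row`). For the shifted quantities
`g i = |e i| - F * h ^ 3 / 24` it becomes homogeneous, and `end_row` adds boundary rows with data `d
= h * δ`, where `δ` bounds the errors of `s''` at `x 0` and `x n`. A discrete maximum principle
(`slope_bounds`) gives `g ≤ d / 3` everywhere and `g ≤ d / 6` inside. The shift contributes `h / 4 *
(F * h ^ 3 / 24) = 4 / 384 * F * h ^ 4`, hence `5 / 384` in all; the rest contributes at most `d * h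
/ 16`.

The last bound is delicate only on the two end intervals. One of length at most `6 / 7 * h` gains
enough from its length; a longer one makes the recurrence give better slopes (`end_slope_bounds`).

Finally `δ` is the error of the second derivative of a quartic interpolant at an end node, found by
Rolle's theorem (`second_error_four`, `second_error_five`). With `δ = 2 * R * h ^ 2 * F` the term `δ
* h ^ 2 / 16` is `R / 8 * F * h ^ 4`. -/

namespace QSpline

/-! ### Derivative chains and Rolle's theorem with several zeros -/

/-- `D 0, ..., D m` are continuous on `[a, b]`, and each is the derivative of its predecessor
on `(a, b)`. -/
structure DerivChain (m : ℕ) (D : ℕ → ℝ → ℝ) (a b : ℝ) : Prop where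
  cont : ∀ k ≤ m, ContinuousOn (D k) (Icc a b)
  deriv : ∀ k < m, ∀ t ∈ Ioo a b, HasDerivAt (D k) (D (k + 1) t) t

namespace DerivChain

variable {m : ℕ} {D : ℕ → ℝ → ℝ} {a b : ℝ}

theorem mono (h : DerivChain m D a b) {a' b' : ℝ} (ha : a ≤ a') (hb : b' ≤ b) :
    DerivChain m D a' b' :=
  ⟨fun k hk => (h.cont k hk).mono (Icc_subset_Icc ha hb),
    fun k hk t ht => h.deriv k hk t (Ioo_subset_Ioo ha hb ht)⟩

theorem sub_polynomial (h : DerivChain m D a b) (P : ℝ[X]) :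
    DerivChain m (fun k t => D k t - (derivative^[k] P).eval t) a b := by
  refine ⟨fun k hk => (h.cont k hk).sub (Polynomial.continuousOn _), fun k hk t ht => ?_⟩
  rw [Function.iterate_succ_apply']
  exact (h.deriv k hk t ht).sub (Polynomial.hasDerivAt _ t)

end DerivChain

/-- Rolle's theorem for a finite set of zeros. -/
theorem exists_finset_deriv_eq_zero {g g' : ℝ → ℝ} {a b : ℝ} (hc : ContinuousOn g (Icc a b))
    (hd : ∀ t ∈ Ioo a b, HasDerivAt g (g' t) t) (Z : Finset ℝ) {k : ℕ} (hZ : Z.card = k + 1)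
    (hZI : ∀ t ∈ Z, t ∈ Icc a b) (hZ0 : ∀ t ∈ Z, g t = 0) :
    ∃ Z' : Finset ℝ, Z'.card = k ∧ (∀ t ∈ Z', t ∈ Ioo a b) ∧ ∀ t ∈ Z', g' t = 0 := by
  let e := Z.orderEmbOfFin hZ
  have hmem : ∀ i, e i ∈ Z := fun i => Z.orderEmbOfFin_mem hZ i
  have key : ∀ i : Fin k, ∃ c ∈ Ioo (e i.castSucc) (e i.succ), g' c = 0 := fun i => by
    have h1 := hZI _ (hmem i.castSucc)
    have h2 := hZI _ (hmem i.succ)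
    refine exists_hasDerivAt_eq_zero (f := g) (e.strictMono i.castSucc_lt_succ)
      (hc.mono (Icc_subset_Icc h1.1 h2.2)) ?_ fun t ht => hd t ?_
    · rw [hZ0 _ (hmem _), hZ0 _ (hmem _)]
    · exact ⟨h1.1.trans_lt ht.1, ht.2.trans_le h2.2⟩
  choose c hcI hc0 using key
  have hmono : StrictMono c := fun i j hij => by
    have : e i.succ ≤ e j.castSucc := e.monotone (by
      rw [Fin.le_def]; simpa using hij)
    exact (hcI i).2.trans_le (this.trans (hcI j).1.le)
  refine ⟨Finset.univ.image c, ?_, ?_, ?_⟩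
  · rw [Finset.card_image_of_injective _ hmono.injective]; simp
  · simp only [Finset.mem_image, Finset.mem_univ, true_and, forall_exists_index,
      forall_apply_eq_imp_iff]
    exact fun i => ⟨(hZI _ (hmem _)).1.trans_lt (hcI i).1, (hcI i).2.trans_le (hZI _ (hmem _)).2⟩
  · simpa using hc0

theorem DerivChain.exists_eq_zero {m : ℕ} {D : ℕ → ℝ → ℝ} {a b : ℝ} (h : DerivChain m D a b)
    (k j : ℕ) (hjk : j + k = m) (Z : Finset ℝ) (hZ : Z.card = k + 1)
    (hZI : ∀ t ∈ Z, t ∈ Icc a b) (hZ0 : ∀ t ∈ Z, D j t = 0) : ∃ ξ ∈ Icc a b, D m ξ = 0 := by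
  induction k generalizing j Z with
  | zero =>
    obtain ⟨t, rfl⟩ := Finset.card_eq_one.1 hZ
    obtain rfl : j = m := hjk
    exact ⟨t, hZI t (by simp), hZ0 t (by simp)⟩
  | succ k ih =>
    obtain ⟨Z', h1, h2, h3⟩ := exists_finset_deriv_eq_zero (h.cont j (by omega))
      (h.deriv j (by omega)) Z hZ hZI hZ0
    exact ih (j + 1) (by omega) Z' h1 (fun t ht => Ioo_subset_Icc_self (h2 t ht)) h3

/-- If `D 0` has `m` zeros and `D 2` vanishes at an end point, then `D m` has a zero. -/
theorem DerivChain.exists_eq_zero_of_second {m : ℕ} {D : ℕ → ℝ → ℝ} {a b z : ℝ}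
    (h : DerivChain m D a b) (hab : a ≤ b) (hm : 3 ≤ m) (Z : Finset ℝ) (hZ : Z.card = m)
    (hZI : ∀ t ∈ Z, t ∈ Icc a b) (hZ0 : ∀ t ∈ Z, D 0 t = 0) (hz : z = a ∨ z = b)
    (hz0 : D 2 z = 0) : ∃ ξ ∈ Icc a b, D m ξ = 0 := by
  obtain ⟨k, rfl⟩ : ∃ k, m = k + 2 := ⟨m - 2, by omega⟩
  obtain ⟨Z1, h1, h2, h3⟩ := exists_finset_deriv_eq_zero (h.cont 0 (by omega))
      (h.deriv 0 (by omega)) Z hZ hZI hZ0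
  obtain ⟨Z2, h4, h5, h6⟩ := exists_finset_deriv_eq_zero (h.cont 1 (by omega))
      (h.deriv 1 (by omega)) Z1 h1 (fun t ht => Ioo_subset_Icc_self (h2 t ht)) h3
  -- Two Rolle steps leave `m - 2` zeros of `D 2` in the open interval, so the end point `z` is a
  -- new one. The `m - 1` zeros allow `m - 2` further steps.
  have hzn : z ∉ Z2 := fun hmem => by
    have := h5 z hmem
    rcases hz with rfl | rfl
    · exact lt_irrefl _ this.1
    · exact lt_irrefl _ this.2
  refine h.exists_eq_zero k 2 (by omega) (insert z Z2) ?_ ?_ ?_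
  · rw [Finset.card_insert_of_notMem hzn, h4]
  · intro t ht
    rcases Finset.mem_insert.1 ht with rfl | ht
    · rcases hz with rfl | rfl
      · exact left_mem_Icc.2 hab
      · exact right_mem_Icc.2 hab
    · exact Ioo_subset_Icc_self (h5 t ht)
  · intro t ht
    rcases Finset.mem_insert.1 ht with rfl | ht
    · exact hz0
    · exact h6 t ht

theorem iterate_derivative_eq_C {P : ℝ[X]} {m : ℕ} (hP : P.natDegree ≤ m) :
    derivative^[m] P = C ((m.factorial : ℝ) * P.coeff m) := by
  ext k
  rw [coeff_iterate_derivative, coeff_C]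
  rcases Nat.eq_zero_or_pos k with rfl | hk
  · simp [Nat.descFactorial_self]
  · rw [if_neg hk.ne', coeff_eq_zero_of_natDegree_lt (by omega), smul_zero]

/-! ### The slope relation on one interval -/

theorem rolle_uIcc {g g' : ℝ → ℝ} {A B : ℝ} (hAB : A ≠ B) (hc : ContinuousOn g (uIcc A B))
    (hd : ∀ t ∈ uIoo A B, HasDerivAt g (g' t) t) (h : g A = g B) :
    ∃ c ∈ uIoo A B, g' c = 0 := by
  rcases hAB.lt_or_gt with hlt | hlt
  · rw [uIcc_of_le hlt.le] at hc
    rw [uIoo_of_le hlt.le] at hd ⊢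
    exact exists_hasDerivAt_eq_zero hlt hc h hd
  · rw [uIcc_of_ge hlt.le] at hc
    rw [uIoo_of_ge hlt.le] at hd ⊢
    exact exists_hasDerivAt_eq_zero hlt hc h.symm hd

theorem left_notMem_uIoo {A B : ℝ} : A ∉ uIoo A B := by
  simpa [uIoo] using le_of_lt

theorem uIoo_subset_of_mem {A B c : ℝ} (hc : c ∈ uIoo A B) : uIoo A c ⊆ uIoo A B := by
  intro t ht
  rcases le_total A B with h | h
  · rw [uIoo_of_le h] at *
    rw [uIoo_of_le hc.1.le] at ht
    exact ⟨ht.1, ht.2.trans hc.2⟩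
  · rw [uIoo_of_ge h] at *
    rw [uIoo_of_ge hc.2.le] at ht
    exact ⟨hc.1.trans ht.1, ht.2⟩

/-- The consistency relation of cubic splines between the slopes at the two ends of an interval
and the second derivative at one of them, with its remainder, for a function vanishing at both
ends. -/
theorem slope_relation {g : ℕ → ℝ → ℝ} {A B : ℝ} (hAB : A ≠ B)
    (hc : ∀ k < 4, ContinuousOn (g k) (uIcc A B))
    (hd : ∀ k < 4, ∀ t ∈ uIoo A B, HasDerivAt (g k) (g (k + 1) t) t)
    (hA : g 0 A = 0) (hB : g 0 B = 0) :
    ∃ ξ ∈ uIoo A B, 2 * g 1 A + g 1 B + (B - A) / 2 * g 2 A = (B - A) ^ 3 / 24 * g 4 ξ := by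
  have hBA : B - A ≠ 0 := sub_ne_zero.2 hAB.symm
  -- `K` makes the auxiliary function below vanish at `B`. That function and its first two
  -- derivatives vanish at `A` for every `K`, so Rolle's theorem applies three times between `A` and
  -- the last point found.
  obtain ⟨K, hK⟩ : ∃ K, -(2 * g 1 A + g 1 B + (B - A) / 2 * g 2 A) = K * (B - A) ^ 3 :=
    ⟨_, (div_mul_cancel₀ _ (pow_ne_zero 3 hBA)).symm⟩
  have hlin : ∀ t : ℝ, HasDerivAt (fun u : ℝ => u - A) 1 t := fun t =>
    (hasDerivAt_id t).sub_const A
  obtain ⟨c, hcm, hc0⟩ := rolle_uIcc (A := A) (B := B)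
    (g := fun t => 3 * g 0 t - (t - A) * g 1 t - 2 * (t - A) * g 1 A
      - (t - A) ^ 2 / 2 * g 2 A - K * (t - A) ^ 4)
    (g' := fun t => 2 * g 1 t - 2 * g 1 A - (t - A) * (g 2 t + g 2 A) - 4 * K * (t - A) ^ 3)
    hAB (by
      have h0 := hc 0 (by omega)
      have h1 := hc 1 (by omega)
      fun_prop) (fun t ht => by
      have h0 := hd 0 (by omega) t ht
      have h1 := hd 1 (by omega) t ht
      refine ((((h0.const_mul 3).sub ((hlin t).mul h1)).sub
        (((hlin t).const_mul 2).mul_const (g 1 A))).sub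
        ((((hlin t).pow 2).div_const 2).mul_const (g 2 A))).sub
        (((hlin t).pow 4).const_mul K) |>.congr_deriv ?_
      norm_num
      ring) (by
      simp only [hA, hB]
      linear_combination (-(B - A)) * hK)
  have hAc : A ≠ c := by
    rintro rfl
    exact left_notMem_uIoo hcm
  have hs1 := uIoo_subset_of_mem hcm
  have hs1' : uIcc A c ⊆ uIcc A B := uIcc_subset_uIcc_left (Ioo_subset_Icc_self hcm)
  obtain ⟨d, hdm, hd0⟩ := rolle_uIcc (A := A) (B := c)
    (g := fun t => 2 * g 1 t - 2 * g 1 A - (t - A) * (g 2 t + g 2 A) - 4 * K * (t - A) ^ 3)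
    (g' := fun t => g 2 t - g 2 A - (t - A) * g 3 t - 12 * K * (t - A) ^ 2)
    hAc (by
      have h0 := (hc 1 (by omega)).mono hs1'
      have h1 := (hc 2 (by omega)).mono hs1'
      fun_prop) (fun t ht => by
      have h0 := hd 1 (by omega) t (hs1 ht)
      have h1 := hd 2 (by omega) t (hs1 ht)
      refine (((h0.const_mul 2).sub_const (2 * g 1 A)).sub
        ((hlin t).mul (h1.add_const (g 2 A)))).sub
        (((hlin t).pow 3).const_mul (4 * K)) |>.congr_deriv ?_
      norm_num
      ring) (by rw [hc0]; ring)
  have hAd : A ≠ d := by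
    rintro rfl
    exact left_notMem_uIoo hdm
  have hs2 := (uIoo_subset_of_mem hdm).trans hs1
  have hs2' : uIcc A d ⊆ uIcc A B :=
    (uIcc_subset_uIcc_left (Ioo_subset_Icc_self hdm)).trans hs1'
  obtain ⟨ξ, hξm, hξ0⟩ := rolle_uIcc (A := A) (B := d)
    (g := fun t => g 2 t - g 2 A - (t - A) * g 3 t - 12 * K * (t - A) ^ 2)
    (g' := fun t => -(t - A) * g 4 t - 24 * K * (t - A))
    hAd (by
      have h0 := (hc 2 (by omega)).mono hs2'
      have h1 := (hc 3 (by omega)).mono hs2'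
      fun_prop) (fun t ht => by
      have h0 := hd 2 (by omega) t (hs2 ht)
      have h1 := hd 3 (by omega) t (hs2 ht)
      refine ((h0.sub_const (g 2 A)).sub ((hlin t).mul h1)).sub
        (((hlin t).pow 2).const_mul (12 * K)) |>.congr_deriv ?_
      norm_num
      ring) (by rw [hd0]; ring)
  have hξA : ξ - A ≠ 0 := by
    rw [sub_ne_zero]
    rintro rfl
    exact left_notMem_uIoo hξm
  refine ⟨ξ, hs2 hξm, ?_⟩
  have : (ξ - A) * (g 4 ξ + 24 * K) = 0 := by linear_combination -hξ0
  have h4 : g 4 ξ + 24 * K = 0 := (mul_eq_zero.1 this).resolve_left hξA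
  linear_combination (-1) * hK - (B - A) ^ 3 / 24 * h4

/-! ### The Hermite remainder -/

/-- The error bound of cubic Hermite interpolation. -/
theorem hermite_bound {g : ℕ → ℝ → ℝ} {a b F : ℝ} (hab : a < b) (h : DerivChain 4 g a b)
    (ha : g 0 a = 0) (hb : g 0 b = 0) (ha' : g 1 a = 0) (hb' : g 1 b = 0)
    (hF : ∀ t ∈ Icc a b, |g 4 t| ≤ F) {t : ℝ} (ht : t ∈ Icc a b) :
    |g 0 t| ≤ F * (b - a) ^ 4 / 384 := by
  have hF0 : 0 ≤ F := (abs_nonneg _).trans (hF a (left_mem_Icc.2 hab.le))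
  rcases eq_or_ne t a with rfl | hta
  · rw [ha]; simp; positivity
  rcases eq_or_ne t b with rfl | htb
  · rw [hb]; simp; positivity
  have hat : a < t := lt_of_le_of_ne ht.1 hta.symm
  have htb' : t < b := lt_of_le_of_ne ht.2 htb
  have hw : (t - a) ^ 2 * (t - b) ^ 2 ≠ 0 := by
    have := sub_ne_zero.2 hta
    have := sub_ne_zero.2 htb
    positivity
  obtain ⟨c, hc⟩ : ∃ c, g 0 t = c * ((t - a) ^ 2 * (t - b) ^ 2) :=
    ⟨_, (div_mul_cancel₀ _ hw).symm⟩
  set P : ℝ[X] := C c * ((X - C a) ^ 2 * (X - C b) ^ 2) with hP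
  have hmon : ((X - C a) ^ 2 * (X - C b) ^ 2 : ℝ[X]).Monic :=
    ((monic_X_sub_C a).pow 2).mul ((monic_X_sub_C b).pow 2)
  have hdeg : ((X - C a) ^ 2 * (X - C b) ^ 2 : ℝ[X]).natDegree = 4 := by
    rw [((monic_X_sub_C a).pow 2).natDegree_mul ((monic_X_sub_C b).pow 2),
      (monic_X_sub_C a).natDegree_pow, (monic_X_sub_C b).natDegree_pow]
    simp
  have hcoe : ((X - C a) ^ 2 * (X - C b) ^ 2 : ℝ[X]).coeff 4 = 1 := by
    have := hmon.coeff_natDegree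
    rwa [hdeg] at this
  have hP4 : derivative^[4] P = C (24 * c) := by
    rw [iterate_derivative_eq_C ((natDegree_C_mul_le _ _).trans hdeg.le), coeff_C_mul, hcoe]
    norm_num [Nat.factorial]
  have hch := h.sub_polynomial P
  obtain ⟨Z, hZ, hZI, hZ0⟩ := exists_finset_deriv_eq_zero (hch.cont 0 (by omega))
    (hch.deriv 0 (by omega)) {a, t, b} (k := 2)
    (by rw [Finset.card_eq_three]; exact ⟨a, t, b, hat.ne, hab.ne, htb'.ne, rfl⟩)
    (by simp [hab.le, ht.1, ht.2]) (by simp [ha, hb, hP, hc])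
  have hbn : b ∉ Z := fun hm => lt_irrefl _ (hZI b hm).2
  have han : a ∉ insert b Z := fun hm => by
    rcases Finset.mem_insert.1 hm with h | hm
    · exact hab.ne h
    · exact lt_irrefl _ (hZI a hm).1
  -- Four zeros of the first derivative: two from Rolle's theorem, and the double nodes `a` and `b`.
  obtain ⟨ξ, hξ, hξ0⟩ := hch.exists_eq_zero 3 1 (by omega) (insert a (insert b Z))
    (by rw [Finset.card_insert_of_notMem han, Finset.card_insert_of_notMem hbn, hZ])
    (by
      simp only [Finset.mem_insert, forall_eq_or_imp]
      exact ⟨left_mem_Icc.2 hab.le, right_mem_Icc.2 hab.le,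
        fun t ht => Ioo_subset_Icc_self (hZI t ht)⟩)
    (by
      simp only [Finset.mem_insert, forall_eq_or_imp]
      exact ⟨by simp [ha', hP, derivative_pow], by simp [hb', hP, derivative_pow], hZ0⟩)
  simp only [hP4, eval_C] at hξ0
  have hcF : |c| ≤ F / 24 := by
    have h1 := hF ξ hξ
    rw [sub_eq_zero.1 hξ0, abs_mul] at h1
    norm_num at h1
    linarith
  have hprod : (t - a) * (b - t) ≤ (b - a) ^ 2 / 4 := by nlinarith [sq_nonneg (2 * t - a - b)]
  have hprod0 : 0 ≤ (t - a) * (b - t) := mul_nonneg (by linarith) (by linarith)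
  have hsq : (t - a) ^ 2 * (t - b) ^ 2 ≤ (b - a) ^ 4 / 16 :=
    calc (t - a) ^ 2 * (t - b) ^ 2 = ((t - a) * (b - t)) ^ 2 := by ring
      _ ≤ ((b - a) ^ 2 / 4) ^ 2 := pow_le_pow_left₀ hprod0 hprod 2
      _ = _ := by ring
  rw [hc, abs_mul, abs_of_nonneg (by positivity : 0 ≤ (t - a) ^ 2 * (t - b) ^ 2)]
  calc |c| * ((t - a) ^ 2 * (t - b) ^ 2) ≤ F / 24 * ((b - a) ^ 4 / 16) := by gcongr
    _ = _ := by ring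

/-! ### Second derivatives of interpolants at an end node -/

/-- The error, at an end point, of the second derivative of an interpolating polynomial. -/
theorem exists_second_deriv_error {m : ℕ} {D : ℕ → ℝ → ℝ} {a b z : ℝ} (h : DerivChain m D a b)
    (hab : a ≤ b) (hm : 3 ≤ m) (Z : Finset ℝ) (hZ : Z.card = m) (hZI : ∀ t ∈ Z, t ∈ Icc a b)
    (hz : z = a ∨ z = b) {p w : ℝ[X]} (hp : p.natDegree ≤ m) (hpZ : ∀ t ∈ Z, p.eval t = D 0 t)
    (hw : w.Monic) (hwd : w.natDegree = m) (hwZ : ∀ t ∈ Z, w.eval t = 0)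
    (hwz : (derivative (derivative w)).eval z ≠ 0) :
    ∃ ξ ∈ Icc a b, D 2 z - (derivative (derivative p)).eval z =
      (D m ξ - m.factorial * p.coeff m) / m.factorial * (derivative (derivative w)).eval z := by
  -- `c` makes the second derivative of `D 0 - p - c * w` vanish at `z`, while the zeros at `Z` are
  -- kept.
  obtain ⟨c, hc⟩ : ∃ c, D 2 z - (derivative (derivative p)).eval z =
      c * (derivative (derivative w)).eval z := ⟨_, (div_mul_cancel₀ _ hwz).symm⟩
  have hwc : w.coeff m = 1 := by
    have := hw.coeff_natDegree
    rwa [hwd] at this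
  obtain ⟨ξ, hξ, hξ0⟩ := (h.sub_polynomial (p + C c * w)).exists_eq_zero_of_second hab hm Z hZ hZI
    (fun t ht => by simp [hpZ t ht, hwZ t ht]) hz
    (by simp only [Function.iterate_succ, Function.comp_apply, Function.iterate_zero, id,
          derivative_add, derivative_C_mul, eval_add, eval_mul, eval_C]
        linear_combination hc)
  refine ⟨ξ, hξ, ?_⟩
  rw [iterate_derivative_eq_C (natDegree_add_le_of_degree_le hp
    ((natDegree_C_mul_le _ _).trans hwd.le)), eval_C, coeff_add, coeff_C_mul, hwc] at hξ0
  have hf : (m.factorial : ℝ) ≠ 0 := by positivity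
  rw [hc]
  congr 1
  field_simp
  linear_combination -hξ0

/-- The monic polynomial with the zeros `y 0, ..., y (m - 1)`. -/
noncomputable def nodalPoly (y : ℕ → ℝ) (m : ℕ) : ℝ[X] := ∏ j ∈ Finset.range m, (X - C (y j))

theorem nodalPoly_monic (y : ℕ → ℝ) (m : ℕ) : (nodalPoly y m).Monic :=
  monic_prod_of_monic _ _ fun _ _ => monic_X_sub_C _

theorem nodalPoly_natDegree (y : ℕ → ℝ) (m : ℕ) : (nodalPoly y m).natDegree = m := by
  rw [nodalPoly, natDegree_prod_of_monic _ _ fun _ _ => monic_X_sub_C _]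
  simp

theorem nodalPoly_eval (y : ℕ → ℝ) {m j : ℕ} (hj : j < m) : (nodalPoly y m).eval (y j) = 0 := by
  rw [nodalPoly, eval_prod]
  exact Finset.prod_eq_zero (Finset.mem_range.2 hj) (by simp)

theorem nodalPoly_four_second (y : ℕ → ℝ) :
    (derivative (derivative (nodalPoly y 4))).eval (y 0) =
      2 * ((y 0 - y 1) * (y 0 - y 2) + (y 0 - y 1) * (y 0 - y 3)
        + (y 0 - y 2) * (y 0 - y 3)) := by
  simp [nodalPoly, Finset.prod_range_succ]
  ring

theorem nodalPoly_five_second (y : ℕ → ℝ) :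
    (derivative (derivative (nodalPoly y 5))).eval (y 0) =
      2 * ((y 0 - y 1) * (y 0 - y 2) * (y 0 - y 3) + (y 0 - y 1) * (y 0 - y 2) * (y 0 - y 4)
        + (y 0 - y 1) * (y 0 - y 3) * (y 0 - y 4) + (y 0 - y 2) * (y 0 - y 3) * (y 0 - y 4)) := by
  simp [nodalPoly, Finset.prod_range_succ]
  ring

/-- Distinct nodes in `[a, b]`, the first of which is an end point, with the distance of the `j`-th
node from the first at most `j * h`. -/
structure EndNodes (y : ℕ → ℝ) (h a b : ℝ) : Prop where
  inj : ∀ i < 5, ∀ j < 5, y i = y j → i = j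
  mem : ∀ i < 5, y i ∈ Icc a b
  zero : y 0 = a ∨ y 0 = b
  dist : ∀ j : ℕ, j < 5 → |y 0 - y j| ≤ j * h

namespace EndNodes

variable {y : ℕ → ℝ} {h a b : ℝ}

theorem card_image (hy : EndNodes y h a b) {m : ℕ} (hm : m ≤ 5) :
    ((Finset.range m).image y).card = m := by
  rw [Finset.card_image_of_injOn, Finset.card_range]
  intro i hi j hj hij
  have h1 := Finset.mem_range.1 (Finset.mem_coe.1 hi)
  have h2 := Finset.mem_range.1 (Finset.mem_coe.1 hj)
  exact hy.inj i (by omega) j (by omega) hij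

/-- As `y 0` is an end point, all differences `y 0 - y j` have one sign. The terms of the second
derivative of the nodal polynomial therefore cannot cancel: it is nonzero and can be estimated term
by term. -/
theorem exists_sign (hy : EndNodes y h a b) : ∃ σ : ℝ, |σ| = 1 ∧ σ ^ 2 = 1 ∧
    ∀ j : ℕ, j < 5 → 0 < j → ∃ v, 0 < v ∧ v ≤ j * h ∧ y 0 - y j = σ * v := by
  have hne : ∀ j : ℕ, j < 5 → 0 < j → y 0 - y j ≠ 0 := fun j hj hj0 => sub_ne_zero.2 fun he =>
    hj0.ne (hy.inj 0 (by omega) j hj he)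
  rcases hy.zero with h0 | h0
  · refine ⟨-1, by simp, by norm_num, fun j hj hj0 => ⟨|y 0 - y j|, abs_pos.2 (hne j hj hj0),
      hy.dist j hj, ?_⟩⟩
    rw [abs_of_nonpos (by have := (hy.mem j hj).1; linarith)]
    ring
  · refine ⟨1, by simp, by norm_num, fun j hj hj0 => ⟨|y 0 - y j|, abs_pos.2 (hne j hj hj0),
      hy.dist j hj, ?_⟩⟩
    rw [abs_of_nonneg (by have := (hy.mem j hj).2; linarith)]
    ring

theorem four_second (hy : EndNodes y h a b) :
    0 < |(derivative (derivative (nodalPoly y 4))).eval (y 0)| ∧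
      |(derivative (derivative (nodalPoly y 4))).eval (y 0)| ≤ 22 * h ^ 2 := by
  obtain ⟨σ, hσ, hσ2, hs⟩ := hy.exists_sign
  obtain ⟨u, hu0, hu, hu'⟩ := hs 1 (by omega) (by omega)
  obtain ⟨v, hv0, hv, hv'⟩ := hs 2 (by omega) (by omega)
  obtain ⟨w, hw0, hw, hw'⟩ := hs 3 (by omega) (by omega)
  have he : (derivative (derivative (nodalPoly y 4))).eval (y 0) =
      2 * (u * v + u * w + v * w) := by
    rw [nodalPoly_four_second, hu', hv', hw']
    linear_combination (2 * (u * v + u * w + v * w)) * hσ2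
  norm_num at hu hv hw
  rw [he, abs_of_pos (by positivity)]
  refine ⟨by positivity, ?_⟩
  calc 2 * (u * v + u * w + v * w) ≤ 2 * (h * (2 * h) + h * (3 * h) + 2 * h * (3 * h)) := by
        gcongr <;> linarith
    _ = 22 * h ^ 2 := by ring

theorem five_second (hy : EndNodes y h a b) :
    0 < |(derivative (derivative (nodalPoly y 5))).eval (y 0)| ∧
      |(derivative (derivative (nodalPoly y 5))).eval (y 0)| ≤ 100 * h ^ 3 := by
  obtain ⟨σ, hσ, hσ2, hs⟩ := hy.exists_sign
  obtain ⟨u, hu0, hu, hu'⟩ := hs 1 (by omega) (by omega)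
  obtain ⟨v, hv0, hv, hv'⟩ := hs 2 (by omega) (by omega)
  obtain ⟨w, hw0, hw, hw'⟩ := hs 3 (by omega) (by omega)
  obtain ⟨r, hr0, hr, hr'⟩ := hs 4 (by omega) (by omega)
  have he : (derivative (derivative (nodalPoly y 5))).eval (y 0) =
      σ * (2 * (u * v * w + u * v * r + u * w * r + v * w * r)) := by
    rw [nodalPoly_five_second, hu', hv', hw', hr']
    linear_combination (σ * (2 * (u * v * w + u * v * r + u * w * r + v * w * r))) * hσ2
  norm_num at hu hv hw hr
  rw [he, abs_mul, hσ, one_mul, abs_of_pos (by positivity)]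
  refine ⟨by positivity, ?_⟩
  have hh : 0 < h := hu0.trans_le hu
  calc 2 * (u * v * w + u * v * r + u * w * r + v * w * r)
      ≤ 2 * (h * (2 * h) * (3 * h) + h * (2 * h) * (4 * h) + h * (3 * h) * (4 * h)
        + 2 * h * (3 * h) * (4 * h)) := by gcongr
    _ = 100 * h ^ 3 := by ring

/-- The error formula is used with four nodes only. The fifth node identifies `24` times the leading
coefficient of `p` as a value of `D 4`, so the factor is at most `2 * F / 24`, and `2 / 24 * 22 = 11
/ 6`. -/
theorem second_error_four (hy : EndNodes y h a b) {D : ℕ → ℝ → ℝ} (hD : DerivChain 4 D a b)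
    (hab : a ≤ b) {p : ℝ[X]} (hp : p.natDegree ≤ 4) (hpy : ∀ j < 5, p.eval (y j) = D 0 (y j))
    {F : ℝ} (hF : ∀ t ∈ Icc a b, |D 4 t| ≤ F) :
    |D 2 (y 0) - (derivative (derivative p)).eval (y 0)| ≤ 11 / 6 * h ^ 2 * F := by
  obtain ⟨hpos, hle⟩ := hy.four_second
  obtain ⟨ξ, hξ, hξe⟩ := exists_second_deriv_error hD hab (by omega) ((Finset.range 4).image y)
    (hy.card_image (by omega)) (by
      simp only [Finset.mem_image, Finset.mem_range]
      rintro _ ⟨j, hj, rfl⟩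
      exact hy.mem j (by omega)) hy.zero hp (by
      simp only [Finset.mem_image, Finset.mem_range]
      rintro _ ⟨j, hj, rfl⟩
      exact hpy j (by omega)) (nodalPoly_monic y 4) (nodalPoly_natDegree y 4) (by
      simp only [Finset.mem_image, Finset.mem_range]
      rintro _ ⟨j, hj, rfl⟩
      exact nodalPoly_eval y hj) (abs_pos.1 hpos)
  obtain ⟨η, hη, hη0⟩ := (hD.sub_polynomial p).exists_eq_zero 4 0 rfl ((Finset.range 5).image y)
    (hy.card_image le_rfl) (by
      simp only [Finset.mem_image, Finset.mem_range]
      rintro _ ⟨j, hj, rfl⟩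
      exact hy.mem j (by omega)) (by
      simp only [Finset.mem_image, Finset.mem_range]
      rintro _ ⟨j, hj, rfl⟩
      simp [hpy j hj])
  rw [iterate_derivative_eq_C hp, eval_C] at hη0
  rw [hξe, ← sub_eq_zero.1 hη0, abs_mul, abs_div]
  have h1 : |D 4 ξ - D 4 η| ≤ 2 * F := by
    have := abs_sub (D 4 ξ) (D 4 η)
    linarith [hF ξ hξ, hF η hη]
  have hF0 : 0 ≤ F := (abs_nonneg _).trans (hF ξ hξ)
  norm_num [Nat.factorial]
  calc |D 4 ξ - D 4 η| / 24 * |(derivative (derivative (nodalPoly y 4))).eval (y 0)|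
      ≤ 2 * F / 24 * (22 * h ^ 2) := by gcongr
    _ = _ := by ring

/-- With all five nodes the coefficient of degree five in `p` is zero, and `100 / 120 = 5 / 6`. -/
theorem second_error_five (hy : EndNodes y h a b) {D : ℕ → ℝ → ℝ} (hD : DerivChain 5 D a b)
    (hab : a ≤ b) {p : ℝ[X]} (hp : p.natDegree ≤ 4) (hpy : ∀ j < 5, p.eval (y j) = D 0 (y j))
    {F : ℝ} (hF : ∀ t ∈ Icc a b, |D 5 t| ≤ F) :
    |D 2 (y 0) - (derivative (derivative p)).eval (y 0)| ≤ 5 / 6 * h ^ 3 * F := by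
  obtain ⟨hpos, hle⟩ := hy.five_second
  obtain ⟨ξ, hξ, hξe⟩ := exists_second_deriv_error hD hab (by omega) ((Finset.range 5).image y)
    (hy.card_image (by omega)) (by
      simp only [Finset.mem_image, Finset.mem_range]
      rintro _ ⟨j, hj, rfl⟩
      exact hy.mem j (by omega)) hy.zero (hp.trans (by omega)) (by
      simp only [Finset.mem_image, Finset.mem_range]
      rintro _ ⟨j, hj, rfl⟩
      exact hpy j (by omega)) (nodalPoly_monic y 5) (nodalPoly_natDegree y 5) (by
      simp only [Finset.mem_image, Finset.mem_range]
      rintro _ ⟨j, hj, rfl⟩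
      exact nodalPoly_eval y hj) (abs_pos.1 hpos)
  have hF0 : 0 ≤ F := (abs_nonneg _).trans (hF ξ hξ)
  rw [hξe, coeff_eq_zero_of_natDegree_lt (by omega), mul_zero, sub_zero, abs_mul, abs_div]
  norm_num [Nat.factorial]
  calc |D 5 ξ| / 120 * |(derivative (derivative (nodalPoly y 5))).eval (y 0)|
      ≤ F / 120 * (100 * h ^ 3) := by gcongr; exact hF ξ hξ
    _ = _ := by ring

end EndNodes

/-! ### The discrete maximum principle -/

/-- Bounds near an end for a diagonally dominant recurrence, if the first step is not small. -/
theorem end_slope_bounds {a b h d g0 g1 g2 : ℝ} (ha : 0 < a) (hb : 0 < b) (hbh : b ≤ h)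
    (hah : 6 / 7 * h ≤ a) (hd : 0 ≤ d) (h0 : 2 * g0 ≤ g1 + d / 2)
    (h1 : 2 * (a + b) * g1 ≤ b * g0 + a * g2) (h2 : g2 ≤ d / 12) :
    g0 ≤ 3 / 10 * d ∧ g1 ≤ 1 / 10 * d := by
  have key : g1 ≤ 1 / 10 * d := by
    have e1 : b * (2 * g0) ≤ b * (g1 + d / 2) := by gcongr
    have e2 : a * g2 ≤ a * (d / 12) := by gcongr
    have e3 : b * d ≤ 7 / 6 * a * d := by
      gcongr
      linarith
    -- Eliminating `g0` and `g2` bounds the left side by `b * d / 4 + a * d / 12`. This is at most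
    -- the right side precisely when `b * d ≤ 7 / 6 * a * d`, whence the threshold `6 / 7`.
    have e4 : (2 * a + 3 / 2 * b) * g1 ≤ (2 * a + 3 / 2 * b) * (1 / 10 * d) := by
      nlinarith
    exact le_of_mul_le_mul_left e4 (by positivity)
  exact ⟨by linarith, key⟩

/-- The discrete maximum principle for the slope errors of a cubic spline. -/
theorem slope_bounds {n : ℕ} (hn : 4 ≤ n) {l g : ℕ → ℝ} {h d : ℝ}
    (hl : ∀ i < n, 0 < l i ∧ l i ≤ h) (hd : 0 ≤ d) (h0 : 2 * g 0 ≤ g 1 + d / 2)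
    (hgn : 2 * g n ≤ g (n - 1) + d / 2)
    (hg : ∀ i, i + 1 < n →
      2 * (l i + l (i + 1)) * g (i + 1) ≤ l i * g (i + 2) + l (i + 1) * g i) :
    (∀ i ≤ n, g i ≤ d / 3) ∧ (∀ i, 0 < i → i < n → g i ≤ d / 6) ∧
      (6 / 7 * h ≤ l 0 → g 0 ≤ 3 / 10 * d ∧ g 1 ≤ 1 / 10 * d) ∧
      (6 / 7 * h ≤ l (n - 1) → g n ≤ 3 / 10 * d ∧ g (n - 1) ≤ 1 / 10 * d) := by
  have half : ∀ (C : ℝ) (i : ℕ), i + 1 < n → g i ≤ C → g (i + 2) ≤ C → g (i + 1) ≤ C / 2 := by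
    intro C i hi h1 h2
    obtain ⟨hp, -⟩ := hl i (by omega)
    obtain ⟨hp', -⟩ := hl (i + 1) hi
    have e1 : l i * g (i + 2) ≤ l i * C := by gcongr
    have e2 : l (i + 1) * g i ≤ l (i + 1) * C := by gcongr
    have e3 := hg i hi
    have e4 : (l i + l (i + 1)) * g (i + 1) ≤ (l i + l (i + 1)) * (C / 2) := by linarith
    exact le_of_mul_le_mul_left e4 (by positivity)
  have third : ∀ i ≤ n, g i ≤ d / 3 := by
    obtain ⟨k, hk, hmax⟩ := (Finset.range (n + 1)).exists_max_image g ⟨0, by simp⟩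
    simp only [Finset.mem_range, Nat.lt_succ_iff] at hk hmax
    suffices g k ≤ d / 3 from fun i hi => (hmax i hi).trans this
    -- A positive maximum cannot be interior, since `half` would halve it. At an end, the neighbour
    -- is at most half the maximum, and the boundary row gives `g k ≤ d / 3`.
    by_contra! hlt
    have hk0 : 0 < g k := by linarith
    have hint : ∀ i, 0 < i → i < n → g i ≤ g k / 2 := fun i h1 h2 => by
      obtain ⟨j, rfl⟩ : ∃ j, i = j + 1 := ⟨i - 1, by omega⟩
      exact half _ j h2 (hmax _ (by omega)) (hmax _ (by omega))
    rcases Nat.eq_zero_or_pos k with rfl | hkp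
    · have := hint 1 (by omega) (by omega)
      linarith
    rcases hk.lt_or_eq with hkn | rfl
    · have := hint k hkp hkn
      linarith
    · have := hint (k - 1) (by omega) (by omega)
      linarith
  have sixth : ∀ i, 0 < i → i < n → g i ≤ d / 6 := fun i h1 h2 => by
    obtain ⟨j, rfl⟩ : ∃ j, i = j + 1 := ⟨i - 1, by omega⟩
    have := half _ j h2 (third _ (by omega)) (third _ (by omega))
    linarith
  -- Both neighbours must be interior. The indices `2` and `n - 2` needed below qualify because `4 ≤
  -- n`.
  have twelfth : ∀ i, 1 < i → i + 1 < n → g i ≤ d / 12 := fun i h1 h2 => by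
    obtain ⟨j, rfl⟩ : ∃ j, i = j + 1 := ⟨i - 1, by omega⟩
    have := half _ j (by omega) (sixth _ (by omega) (by omega)) (sixth _ (by omega) (by omega))
    linarith
  refine ⟨third, sixth, fun hh => ?_, fun hh => ?_⟩
  · have := hg 0 (by omega)
    exact end_slope_bounds (hl 0 (by omega)).1 (hl 1 (by omega)).1 (hl 1 (by omega)).2 hh hd h0
      (by norm_num at this; linarith) (twelfth 2 (by omega) (by omega))
  · obtain ⟨m, rfl⟩ : ∃ m, n = m + 2 := ⟨n - 2, by omega⟩
    have := hg m (by omega)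
    exact end_slope_bounds (hl (m + 1) (by omega)).1 (hl m (by omega)).1 (hl m (by omega)).2 hh hd
      hgn (by simpa [add_comm] using this) (twelfth m (by omega) (by omega))

/-! ### From slope errors to the error on an interval -/

/-- An error bound on one interval in terms of the slope errors at its ends. -/
theorem interval_bound {g : ℕ → ℝ → ℝ} {a b F u v : ℝ} (hab : a < b) (h : DerivChain 4 g a b)
    (ha : g 0 a = 0) (hb : g 0 b = 0) (hu : |g 1 a| ≤ u) (hv : |g 1 b| ≤ v)
    (hF : ∀ t ∈ Icc a b, |g 4 t| ≤ F) {t : ℝ} (ht : t ∈ Icc a b) :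
    ∃ τ ∈ Icc (0 : ℝ) 1, |g 0 t| ≤
      F * (b - a) ^ 4 / 384 + (b - a) * (τ * (1 - τ) * (u * (1 - τ) + v * τ)) := by
  have hL : b - a ≠ 0 := (sub_pos.2 hab).ne'
  obtain ⟨τ, hτ⟩ : ∃ τ, t - a = τ * (b - a) := ⟨_, (div_mul_cancel₀ _ hL).symm⟩
  have hL0 := sub_pos.2 hab
  have hτ0 : 0 ≤ τ := by
    have := ht.1
    by_contra! hc
    nlinarith
  have hτ1 : τ ≤ 1 := by
    have := ht.2
    by_contra! hc
    nlinarith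
  refine ⟨τ, ⟨hτ0, hτ1⟩, ?_⟩
  -- The cubic with zero values and the slopes of `g 0` at `a` and `b`. Subtracting it produces a
  -- Hermite remainder and leaves `g 4` unchanged.
  set W : ℝ[X] := C (g 1 a / (b - a) ^ 2) * ((X - C a) * (X - C b) ^ 2)
    + C (g 1 b / (b - a) ^ 2) * ((X - C a) ^ 2 * (X - C b)) with hW
  have hWd : W.natDegree ≤ 3 := by
    rw [hW]
    compute_degree
  have hW4 : derivative^[4] W = 0 := iterate_derivative_eq_zero (by omega)
  have hWt : W.eval t = (b - a) * (τ * (1 - τ) * (g 1 a * (1 - τ) - g 1 b * τ)) := by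
    have h2 : t - b = (τ - 1) * (b - a) := by linear_combination hτ
    simp only [hW, eval_add, eval_mul, eval_C, eval_pow, eval_sub, eval_X, hτ, h2]
    field_simp
    ring
  have hWa : (derivative W).eval a = g 1 a := by
    simp [hW, derivative_pow]
    field_simp
    ring
  have hWb : (derivative W).eval b = g 1 b := by
    simp [hW, derivative_pow]
    field_simp
  have key := hermite_bound hab (h.sub_polynomial W) (by simp [ha, hW]) (by simp [hb, hW])
    (by simp [hWa]) (by simp [hWb]) (F := F) (by simpa [hW4] using hF) ht
  simp only [Function.iterate_zero, id] at key
  have hWb : |W.eval t| ≤ (b - a) * (τ * (1 - τ) * (u * (1 - τ) + v * τ)) := by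
    have h1 : 0 ≤ 1 - τ := by linarith
    rw [hWt, abs_mul, abs_mul, abs_of_pos hL0, abs_of_nonneg (mul_nonneg hτ0 h1)]
    gcongr
    refine (abs_sub _ _).trans ?_
    rw [abs_mul, abs_mul, abs_of_nonneg h1, abs_of_nonneg hτ0]
    gcongr
  calc |g 0 t| = |(g 0 t - W.eval t) + W.eval t| := by ring_nf
    _ ≤ _ := (abs_add_le _ _).trans (add_le_add key hWb)

/-- The combination of the interval bound with the slope bounds. -/
theorem interval_bound' {g : ℕ → ℝ → ℝ} {a b F h d p q : ℝ} (hab : a < b)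
    (hbh : b - a ≤ h) (hd : 0 ≤ d) (hc : DerivChain 4 g a b)
    (ha : g 0 a = 0) (hb : g 0 b = 0) (hp : |g 1 a| - F * h ^ 3 / 24 ≤ p * d)
    (hq : |g 1 b| - F * h ^ 3 / 24 ≤ q * d)
    (hpq : ∀ τ ∈ Icc (0 : ℝ) 1, (b - a) * (τ * (1 - τ) * (p * (1 - τ) + q * τ)) ≤ h / 16)
    (hF : ∀ t ∈ Icc a b, |g 4 t| ≤ F) {t : ℝ} (ht : t ∈ Icc a b) :
    |g 0 t| ≤ 5 / 384 * F * h ^ 4 + d * h / 16 := by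
  obtain ⟨τ, hτ, hle⟩ := interval_bound hab hc ha hb (u := F * h ^ 3 / 24 + p * d)
    (v := F * h ^ 3 / 24 + q * d) (by linarith) (by linarith) hF ht
  have hF0 : 0 ≤ F := (abs_nonneg _).trans (hF t ht)
  have hL0 := sub_pos.2 hab
  have hh : 0 < h := hL0.trans_le hbh
  have e1 : F * (b - a) ^ 4 / 384 ≤ F * h ^ 4 / 384 := by gcongr
  have hτq : τ * (1 - τ) ≤ 1 / 4 := by nlinarith [sq_nonneg (2 * τ - 1)]
  have hτ0 : 0 ≤ τ * (1 - τ) := mul_nonneg hτ.1 (by linarith [hτ.2])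
  have e2 : (b - a) * (τ * (1 - τ)) * (F * h ^ 3 / 24) ≤ h * (1 / 4) * (F * h ^ 3 / 24) := by
    gcongr
  have e3 := mul_le_mul_of_nonneg_right (hpq τ hτ) hd
  refine hle.trans ?_
  linarith

/-- The maximum slightly exceeds `1 / 16`, so this serves only for end intervals of length at most
`6 / 7 * h`: `6 / 7 * (7 / 96) = 1 / 16`. -/
theorem cubic_weight_bound_small {τ : ℝ} (hτ : τ ∈ Icc (0 : ℝ) 1) :
    τ * (1 - τ) * (1 / 3 * (1 - τ) + 1 / 6 * τ) ≤ 7 / 96 := by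
  obtain ⟨h0, h1⟩ := hτ
  nlinarith [mul_nonneg h0 (sq_nonneg (τ - 1 / 2)), sq_nonneg (τ - 1 / 2), sq_nonneg (τ - 2 / 5)]

theorem cubic_weight_bound_large {τ : ℝ} (hτ : τ ∈ Icc (0 : ℝ) 1) :
    τ * (1 - τ) * (3 / 10 * (1 - τ) + 1 / 10 * τ) ≤ 1 / 16 := by
  obtain ⟨h0, h1⟩ := hτ
  nlinarith [mul_nonneg h0 (sq_nonneg (τ - 1 / 2)), sq_nonneg (τ - 1 / 2), sq_nonneg (τ - 2 / 5),
    mul_nonneg (sub_nonneg.2 h1) (sq_nonneg (τ - 2 / 5))]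

/-! ### The system for the slope errors and the spline bound -/

/-- `q` is a cubic interpolating `D 0` at `a` and `b`, with slopes `u a`, `u b` there
and second derivatives `c a`, `c b`. -/
structure IsCubicPiece (q : ℝ[X]) (D : ℕ → ℝ → ℝ) (u c : ℝ → ℝ) (a b : ℝ) : Prop where
  natDegree_le : q.natDegree ≤ 3
  left : q.eval a = D 0 a
  right : q.eval b = D 0 b
  left_slope : (derivative q).eval a = u a
  right_slope : (derivative q).eval b = u b
  left_second : (derivative (derivative q)).eval a = c a
  right_second : (derivative (derivative q)).eval b = c b

namespace IsCubicPiece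

variable {q : ℝ[X]} {D : ℕ → ℝ → ℝ} {u c : ℝ → ℝ} {a b F : ℝ}

theorem iterate_derivative (hq : IsCubicPiece q D u c a b) : derivative^[4] q = 0 :=
  iterate_derivative_eq_zero (by have := hq.natDegree_le; omega)

theorem slope_relations (hq : IsCubicPiece q D u c a b) (hab : a < b) (hD : DerivChain 4 D a b)
    (hF : ∀ t ∈ Icc a b, |D 4 t| ≤ F) :
    |2 * (D 1 a - u a) + (D 1 b - u b) + (b - a) / 2 * (D 2 a - c a)| ≤ F * (b - a) ^ 3 / 24 ∧
    |2 * (D 1 b - u b) + (D 1 a - u a) - (b - a) / 2 * (D 2 b - c b)|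
      ≤ F * (b - a) ^ 3 / 24 := by
  have hL0 := sub_pos.2 hab
  have hch := hD.sub_polynomial q
  have e1 := slope_relation (A := a) (B := b) hab.ne
    (by rw [uIcc_of_le hab.le]; exact fun k hk => hch.cont k hk.le)
    (by rw [uIoo_of_le hab.le]; exact hch.deriv)
    (by simp [hq.left]) (by simp [hq.right])
  have e2 := slope_relation (A := b) (B := a) hab.ne'
    (by rw [uIcc_of_ge hab.le]; exact fun k hk => hch.cont k hk.le)
    (by rw [uIoo_of_ge hab.le]; exact hch.deriv)
    (by simp [hq.right]) (by simp [hq.left])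
  rw [uIoo_of_le hab.le] at e1
  rw [uIoo_of_ge hab.le] at e2
  simp only [hq.iterate_derivative, eval_zero, sub_zero, Function.iterate_succ,
    Function.iterate_zero, Function.comp_apply, id, hq.left_slope, hq.right_slope,
    hq.left_second, hq.right_second] at e1 e2
  obtain ⟨ξ, hξ, hξe⟩ := e1
  obtain ⟨η, hη, hηe⟩ := e2
  have h1 := hF ξ (Ioo_subset_Icc_self hξ)
  have h2 := hF η (Ioo_subset_Icc_self hη)
  constructor
  · rw [hξe, abs_mul, abs_of_pos (by positivity)]
    calc (b - a) ^ 3 / 24 * |D 4 ξ| ≤ (b - a) ^ 3 / 24 * F := by gcongr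
      _ = _ := by ring
  · rw [show 2 * (D 1 b - u b) + (D 1 a - u a) - (b - a) / 2 * (D 2 b - c b)
      = -((b - a) ^ 3 / 24 * D 4 η) by linear_combination hηe, abs_neg, abs_mul,
      abs_of_pos (by positivity)]
    calc (b - a) ^ 3 / 24 * |D 4 η| ≤ (b - a) ^ 3 / 24 * F := by gcongr
      _ = _ := by ring

end IsCubicPiece

/-- Weighting the relation on the right by `a` and that on the left by `b` cancels `c`. The
remainder is at most `(a + b) * (F * h ^ 3 / 24)`, which is exactly what the shift absorbs, as the
row sums differ by `a + b`. -/
theorem interior_row {a b h F e₀ e₁ e₂ c : ℝ} (ha : 0 < a) (hb : 0 < b) (hah : a ≤ h) (hbh : b ≤ h)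
    (hF : 0 ≤ F) (hl : |2 * e₁ + e₀ - a / 2 * c| ≤ F * a ^ 3 / 24)
    (hr : |2 * e₁ + e₂ + b / 2 * c| ≤ F * b ^ 3 / 24) :
    2 * (a + b) * (|e₁| - F * h ^ 3 / 24) ≤
      a * (|e₂| - F * h ^ 3 / 24) + b * (|e₀| - F * h ^ 3 / 24) := by
  have hh : 0 < h := ha.trans_le hah
  have e : 2 * (a + b) * e₁ = a * (2 * e₁ + e₂ + b / 2 * c) + b * (2 * e₁ + e₀ - a / 2 * c)
      - a * e₂ - b * e₀ := by ring
  have e' : 2 * (a + b) * |e₁| ≤ a * (F * b ^ 3 / 24) + b * (F * a ^ 3 / 24)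
      + a * |e₂| + b * |e₀| := by
    calc 2 * (a + b) * |e₁| = |2 * (a + b) * e₁| := by
          rw [abs_mul, abs_of_pos (by positivity : 0 < 2 * (a + b))]
      _ ≤ |a * (2 * e₁ + e₂ + b / 2 * c)| + |b * (2 * e₁ + e₀ - a / 2 * c)|
          + |a * e₂| + |b * e₀| := by
          rw [e]
          refine (abs_sub _ _).trans (add_le_add_left ((abs_sub _ _).trans
            (add_le_add_left (abs_add_le _ _) _)) _)
      _ ≤ _ := by
          simp only [abs_mul, abs_of_pos ha, abs_of_pos hb]
          gcongr
  have k : a * b ^ 3 + b * a ^ 3 ≤ (a + b) * h ^ 3 := by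
    have k1 : a * b ^ 3 + b * a ^ 3 ≤ a * b * (2 * h ^ 2) := by
      have : a ^ 2 + b ^ 2 ≤ 2 * h ^ 2 := by
        have := pow_le_pow_left₀ ha.le hah 2
        have := pow_le_pow_left₀ hb.le hbh 2
        linarith
      calc a * b ^ 3 + b * a ^ 3 = a * b * (a ^ 2 + b ^ 2) := by ring
        _ ≤ _ := by gcongr
    have k2 : 2 * (a * b) ≤ (a + b) * h := by
      have := mul_le_mul_of_nonneg_left hbh ha.le
      have := mul_le_mul_of_nonneg_left hah hb.le
      linarith
    have k3 := mul_le_mul_of_nonneg_right k2 (sq_nonneg h)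
    linarith
  have k' := mul_le_mul_of_nonneg_left k hF
  linarith

theorem end_row {a h F e₀ e₁ c δ : ℝ} (ha : 0 < a) (hah : a ≤ h) (hF : 0 ≤ F) (hc : |c| ≤ δ)
    (hr : |2 * e₀ + e₁ + a / 2 * c| ≤ F * a ^ 3 / 24) :
    2 * (|e₀| - F * h ^ 3 / 24) ≤ |e₁| - F * h ^ 3 / 24 + h * δ / 2 := by
  have hh : 0 < h := ha.trans_le hah
  have e : 2 * e₀ = (2 * e₀ + e₁ + a / 2 * c) - e₁ - a / 2 * c := by ring
  have e' : 2 * |e₀| ≤ F * h ^ 3 / 24 + |e₁| + h / 2 * δ := by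
    calc 2 * |e₀| = |2 * e₀| := by rw [abs_mul]; norm_num
      _ ≤ |2 * e₀ + e₁ + a / 2 * c| + |e₁| + |a / 2 * c| := by
        calc |2 * e₀| = |(2 * e₀ + e₁ + a / 2 * c) - e₁ - a / 2 * c| := congrArg _ e
          _ ≤ _ := (abs_sub _ _).trans (add_le_add_left (abs_sub _ _) _)
      _ ≤ _ := by
        rw [abs_mul, abs_of_pos (by positivity : 0 < a / 2)]
        gcongr
        exact hr.trans (by gcongr)
  linarith

/-- The error of a cubic spline interpolant whose second derivatives at the two ends have an
error of at most `δ`. -/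
theorem spline_bound {n : ℕ} (hn : 4 ≤ n) {x : ℕ → ℝ} {h F δ : ℝ}
    (hx : ∀ i < n, x i < x (i + 1)) (hxh : ∀ i < n, x (i + 1) - x i ≤ h) {D : ℕ → ℝ → ℝ}
    (hD : ∀ i < n, DerivChain 4 D (x i) (x (i + 1)))
    (hF : ∀ i < n, ∀ t ∈ Icc (x i) (x (i + 1)), |D 4 t| ≤ F) {q : ℕ → ℝ[X]} {u c : ℝ → ℝ}
    (hq : ∀ i < n, IsCubicPiece (q i) D u c (x i) (x (i + 1)))
    (h0 : |D 2 (x 0) - c (x 0)| ≤ δ) (hn' : |D 2 (x n) - c (x n)| ≤ δ)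
    {i : ℕ} (hi : i < n) {t : ℝ} (ht : t ∈ Icc (x i) (x (i + 1))) :
    |D 0 t - (q i).eval t| ≤ 5 / 384 * F * h ^ 4 + δ * h ^ 2 / 16 := by
  have hF0 : 0 ≤ F := (abs_nonneg _).trans (hF i hi t ht)
  have hpos : ∀ i < n, 0 < x (i + 1) - x i := fun i hi => sub_pos.2 (hx i hi)
  have hh : 0 < h := (hpos i hi).trans_le (hxh i hi)
  have hδ : 0 ≤ δ := (abs_nonneg _).trans h0
  have hrel := fun i hi => (hq i hi).slope_relations (hx i hi) (hD i hi) (hF i hi)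
  obtain ⟨m, rfl⟩ : ∃ m, n = m + 1 := ⟨n - 1, by omega⟩
  obtain ⟨third, sixth, hleft, hright⟩ := slope_bounds hn
    (l := fun i => x (i + 1) - x i) (h := h) (d := h * δ)
    (g := fun i => |D 1 (x i) - u (x i)| - F * h ^ 3 / 24)
    (fun i hi => ⟨hpos i hi, hxh i hi⟩) (by positivity)
    (end_row (hpos 0 (by omega)) (hxh 0 (by omega)) hF0 h0 (hrel 0 (by omega)).1)
    -- Seen from the right end the interval is traversed backwards, which flips the sign of the
    -- second-derivative term.
    (end_row (c := -(D 2 (x (m + 1)) - c (x (m + 1)))) (hpos m (by omega)) (hxh m (by omega)) hF0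
      (by rwa [abs_neg]) (by
        have := (hrel m (by omega)).2
        rwa [sub_eq_add_neg, ← mul_neg] at this))
    (fun i hi => interior_row (hpos i (by omega)) (hpos (i + 1) hi) (hxh i (by omega))
      (hxh (i + 1) hi) hF0 (hrel i (by omega)).2 (hrel (i + 1) hi).1)
  simp only [Nat.add_sub_cancel] at hright
  have hch := (hD i hi).sub_polynomial (q i)
  have main : ∀ p r : ℝ, |D 1 (x i) - u (x i)| - F * h ^ 3 / 24 ≤ p * (h * δ) →
      |D 1 (x (i + 1)) - u (x (i + 1))| - F * h ^ 3 / 24 ≤ r * (h * δ) →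
      (∀ τ ∈ Icc (0 : ℝ) 1,
        (x (i + 1) - x i) * (τ * (1 - τ) * (p * (1 - τ) + r * τ)) ≤ h / 16) →
      |D 0 t - (q i).eval t| ≤ 5 / 384 * F * h ^ 4 + δ * h ^ 2 / 16 := by
    intro p r hp hr hpr
    have := interval_bound' (hx i hi) (hxh i hi) (by positivity : 0 ≤ h * δ) hch
      (by simp [(hq i hi).left]) (by simp [(hq i hi).right])
      (by simpa [(hq i hi).left_slope] using hp) (by simpa [(hq i hi).right_slope] using hr)
      hpr (F := F) (by simpa only [(hq i hi).iterate_derivative, eval_zero, sub_zero] using hF i hi)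
      ht
    simp only [Function.iterate_zero, id] at this
    linarith
  have hLpos := hpos i hi
  have hflip : ∀ {τ : ℝ}, τ ∈ Icc (0 : ℝ) 1 → 1 - τ ∈ Icc (0 : ℝ) 1 := fun hτ =>
    ⟨by linarith [hτ.2], by linarith [hτ.1]⟩
  rcases Nat.eq_zero_or_pos i with rfl | hi0
  · rcases le_total (6 / 7 * h) (x (0 + 1) - x 0) with hle | hle
    · refine main _ _ (hleft hle).1 (hleft hle).2 fun τ hτ => ?_
      calc _ ≤ (x (0 + 1) - x 0) * (1 / 16) := by gcongr; exact cubic_weight_bound_large hτ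
        _ ≤ h * (1 / 16) := by gcongr; exact hxh 0 hi
        _ = _ := by ring
    · refine main (1 / 3) (1 / 6) (by have := third 0 (by omega); linarith)
        (by have := sixth 1 (by omega) (by omega); norm_num at this ⊢; linarith) fun τ hτ => ?_
      calc _ ≤ (x (0 + 1) - x 0) * (7 / 96) := by gcongr; exact cubic_weight_bound_small hτ
        _ ≤ 6 / 7 * h * (7 / 96) := by gcongr
        _ = _ := by ring
  rcases (Nat.lt_succ_iff.1 hi).eq_or_lt with rfl | him
  · rcases le_total (6 / 7 * h) (x (i + 1) - x i) with hle | hle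
    · refine main _ _ (hright hle).2 (hright hle).1 fun τ hτ => ?_
      have := cubic_weight_bound_large (hflip hτ)
      calc _ ≤ (x (i + 1) - x i) * (1 / 16) := by gcongr; linarith
        _ ≤ h * (1 / 16) := by gcongr; exact hxh i hi
        _ = _ := by ring
    · refine main (1 / 6) (1 / 3) (by have := sixth i hi0 (by omega); linarith)
        (by have := third (i + 1) (by omega); linarith) fun τ hτ => ?_
      have := cubic_weight_bound_small (hflip hτ)
      calc _ ≤ (x (i + 1) - x i) * (7 / 96) := by gcongr; linarith
        _ ≤ 6 / 7 * h * (7 / 96) := by gcongr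
        _ = _ := by ring
  · refine main (1 / 6) (1 / 6) (by have := sixth i hi0 (by omega); linarith)
      (by have := sixth (i + 1) (by omega) (by omega); linarith) fun τ hτ => ?_
    -- The true maximum is `1 / 24`; interior intervals have room to spare.
    have hw : τ * (1 - τ) * (1 / 6 * (1 - τ) + 1 / 6 * τ) ≤ 1 / 16 := by
      nlinarith [sq_nonneg (2 * τ - 1)]
    calc _ ≤ (x (i + 1) - x i) * (1 / 16) := by gcongr
      _ ≤ h * (1 / 16) := by gcongr; exact hxh i hi
      _ = _ := by ring

/-! ### Iterated derivatives within an interval -/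

theorem derivChain_iteratedDerivWithin {m : ℕ} {f : ℝ → ℝ} {a b : ℝ} (hab : a < b)
    (hf : ContDiffOn ℝ m f (Icc a b)) :
    DerivChain m (fun k => iteratedDerivWithin k f (Icc a b)) a b := by
  have hu := uniqueDiffOn_Icc hab
  refine ⟨fun k hk => hf.continuousOn_iteratedDerivWithin (by exact_mod_cast hk) hu,
    fun k hk t ht => ?_⟩
  rw [iteratedDerivWithin_succ]
  have h := hf.differentiableOn_iteratedDerivWithin (m := k) (by exact_mod_cast hk) hu t
    (Ioo_subset_Icc_self ht)
  exact h.hasDerivWithinAt.hasDerivAt (Icc_mem_nhds ht.1 ht.2)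

theorem abs_le_derivNorm {k : ℕ} {f : ℝ → ℝ} {a b : ℝ} (hab : a < b)
    (hf : ContDiffOn ℝ k f (Icc a b)) {t : ℝ} (ht : t ∈ Icc a b) :
    |iteratedDerivWithin k f (Icc a b) t| ≤ derivNorm k f a b :=
  (hf.continuousOn_iteratedDerivWithin le_rfl (uniqueDiffOn_Icc hab)).abs.le_sSup_image_Icc ht

theorem iteratedDerivWithin_Icc_subset {k : ℕ} {f : ℝ → ℝ} {a b a' b' : ℝ} (hab : a' < b')
    (ha : a ≤ a') (hb : b' ≤ b) (hf : ContDiffOn ℝ k f (Icc a b)) {t : ℝ} (ht : t ∈ Icc a' b') :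
    iteratedDerivWithin k f (Icc a' b') t = iteratedDerivWithin k f (Icc a b) t := by
  rw [iteratedDerivWithin, iteratedDerivWithin,
    iteratedFDerivWithin_subset (Icc_subset_Icc ha hb) (uniqueDiffOn_Icc hab)
      (uniqueDiffOn_Icc (ha.trans_lt (hab.trans_le hb))) hf ht]

theorem iteratedDerivWithin_eval (q : ℝ[X]) {a b : ℝ} (hab : a < b) (k : ℕ) {t : ℝ}
    (ht : t ∈ Icc a b) :
    iteratedDerivWithin k (fun y => q.eval y) (Icc a b) t = (derivative^[k] q).eval t := by
  induction k generalizing t with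
  | zero => simp
  | succ k ih =>
    rw [iteratedDerivWithin_succ, derivWithin_congr (fun y hy => ih hy) (ih ht),
      Polynomial.derivWithin _ (uniqueDiffOn_Icc hab t ht), Function.iterate_succ_apply']

/-! ### Knots, end conditions and the constant `R` -/

section Knots

variable {n : ℕ} {x : ℕ → ℝ}

theorem step_le_meshSize {i : ℕ} (hi : i < n) : x (i + 1) - x i ≤ meshSize n x :=
  le_ciSup (f := fun i : Fin n => x (i + 1) - x i) (Set.finite_range _).bddAbove ⟨i, hi⟩

theorem knot_lt (hx : ∀ i < n, x i < x (i + 1)) {i j : ℕ} (hij : i < j) (hj : j ≤ n) :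
    x i < x j := by
  induction j, hij using Nat.le_induction with
  | base => exact hx i (by omega)
  | succ k hk ih => exact (ih (by omega)).trans (hx k (by omega))

theorem knot_le (hx : ∀ i < n, x i < x (i + 1)) {i j : ℕ} (hij : i ≤ j) (hj : j ≤ n) :
    x i ≤ x j := by
  rcases hij.eq_or_lt with rfl | h
  · exact le_rfl
  · exact (knot_lt hx h hj).le

theorem knot_inj (hx : ∀ i < n, x i < x (i + 1)) {i j : ℕ} (hi : i ≤ n) (hj : j ≤ n)
    (h : x i = x j) : i = j := by
  rcases lt_trichotomy i j with hlt | rfl | hlt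
  · exact absurd h (knot_lt hx hlt hj).ne
  · rfl
  · exact absurd h (knot_lt hx hlt hi).ne'

theorem knot_add_sub_le (i k : ℕ) (h : i + k ≤ n) : x (i + k) - x i ≤ k * meshSize n x := by
  induction k with
  | zero => simp
  | succ k ih =>
    have h1 := ih (by omega)
    have h2 := step_le_meshSize (x := x) (show i + k < n by omega)
    push_cast
    rw [← add_assoc]
    linarith

theorem exists_mem_step (hn : 0 < n) {t : ℝ} (ht : t ∈ Icc (x 0) (x n)) :
    ∃ i < n, t ∈ Icc (x i) (x (i + 1)) := by
  induction n, hn using Nat.le_induction with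
  | base => exact ⟨0, by omega, ht⟩
  | succ k hk ih =>
    rcases le_total t (x k) with h | h
    · obtain ⟨i, hi, hti⟩ := ih ⟨ht.1, h⟩
      exact ⟨i, by omega, hti⟩
    · exact ⟨k, by omega, h, ht.2⟩

theorem endNodes_left (hn : 4 ≤ n) (hx : ∀ i < n, x i < x (i + 1)) {b : ℝ} (hb : x 4 ≤ b) :
    EndNodes x (meshSize n x) (x 0) b where
  inj i hi j hj := knot_inj hx (by omega) (by omega)
  mem i hi := ⟨knot_le hx (by omega) (by omega), (knot_le hx (by omega) hn).trans hb⟩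
  zero := Or.inl rfl
  dist j hj := by
    have h1 := knot_add_sub_le (x := x) 0 j (by omega : 0 + j ≤ n)
    rw [zero_add] at h1
    rw [abs_sub_comm, abs_of_nonneg (sub_nonneg.2 (knot_le hx (by omega) (by omega)))]
    exact h1

/-- Numbering the nodes backwards makes `x n` the first one, so the estimates at the left end serve
here too. -/
theorem endNodes_right (hn : 4 ≤ n) (hx : ∀ i < n, x i < x (i + 1)) {a : ℝ}
    (ha : a ≤ x (n - 4)) : EndNodes (fun j => x (n - j)) (meshSize n x) a (x n) where
  inj i hi j hj h := by
    have := knot_inj hx (by omega) (by omega) h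
    omega
  mem i hi := ⟨ha.trans (knot_le hx (by omega) (by omega)), knot_le hx (by omega) le_rfl⟩
  zero := Or.inr rfl
  dist j hj := by
    have h1 := knot_add_sub_le (x := x) (n - j) j (by omega : n - j + j ≤ n)
    rw [Nat.sub_add_cancel (by omega)] at h1
    rw [Nat.sub_zero, abs_of_nonneg (sub_nonneg.2 (knot_le hx (by omega) le_rfl))]
    exact h1

variable {f : ℝ → ℝ}

theorem quartic_injOn (hx : ∀ i < n, x i < x (i + 1)) {m : ℕ} (hm : m + 4 ≤ n) :
    Set.InjOn x (Finset.Icc m (m + 4) : Finset ℕ) := fun i hi j hj => by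
  have h1 := Finset.mem_Icc.1 (Finset.mem_coe.1 hi)
  have h2 := Finset.mem_Icc.1 (Finset.mem_coe.1 hj)
  exact knot_inj hx (by omega) (by omega)

theorem quartic_eval (hx : ∀ i < n, x i < x (i + 1)) {m j : ℕ} (hm : m + 4 ≤ n) (hmj : m ≤ j)
    (hj : j ≤ m + 4) : (quartic x f m).eval (x j) = f (x j) :=
  Lagrange.eval_interpolate_at_node _ (quartic_injOn hx hm) (Finset.mem_Icc.2 ⟨hmj, hj⟩)

theorem quartic_natDegree_le (hx : ∀ i < n, x i < x (i + 1)) {m : ℕ} (hm : m + 4 ≤ n) :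
    (quartic x f m).natDegree ≤ 4 := by
  rw [natDegree_le_iff_degree_le]
  refine (Lagrange.degree_interpolate_le _ (quartic_injOn hx hm)).trans ?_
  rw [Nat.card_Icc, show m + 4 + 1 - m - 1 = 4 by omega]

theorem second_error_left_four (hn : 4 ≤ n) (hx : ∀ i < n, x i < x (i + 1))
    (hf : ContDiffOn ℝ 4 f (Icc (x 0) (x n))) :
    |iteratedDerivWithin 2 f (Icc (x 0) (x n)) (x 0)
      - (derivative (derivative (quartic x f 0))).eval (x 0)| ≤
      11 / 6 * meshSize n x ^ 2 * derivNorm 4 f (x 0) (x n) := by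
  have h0n := knot_lt hx (show 0 < n by omega) le_rfl
  exact (endNodes_left hn hx (knot_le hx hn le_rfl)).second_error_four
    (derivChain_iteratedDerivWithin h0n hf) h0n.le (quartic_natDegree_le hx (by omega))
    (fun j hj => by
      rw [quartic_eval hx (by omega) (by omega) (by omega), iteratedDerivWithin_zero])
    (fun t ht => abs_le_derivNorm h0n hf ht)

theorem second_error_right_four (hn : 4 ≤ n) (hx : ∀ i < n, x i < x (i + 1))
    (hf : ContDiffOn ℝ 4 f (Icc (x 0) (x n))) :
    |iteratedDerivWithin 2 f (Icc (x 0) (x n)) (x n)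
      - (derivative (derivative (quartic x f (n - 4)))).eval (x n)| ≤
      11 / 6 * meshSize n x ^ 2 * derivNorm 4 f (x 0) (x n) := by
  have h0n := knot_lt hx (show 0 < n by omega) le_rfl
  exact (endNodes_right hn hx (knot_le hx (by omega) (by omega))).second_error_four
    (derivChain_iteratedDerivWithin h0n hf) h0n.le (quartic_natDegree_le hx (by omega))
    (fun j hj => by
      rw [quartic_eval hx (by omega) (by omega) (by omega), iteratedDerivWithin_zero])
    (fun t ht => abs_le_derivNorm h0n hf ht)

theorem second_error_left_five (hn : 4 ≤ n) (hx : ∀ i < n, x i < x (i + 1))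
    (hf : ContDiffOn ℝ 4 f (Icc (x 0) (x n))) (hf5 : ContDiffOn ℝ 5 f (Icc (x 0) (x 4))) :
    |iteratedDerivWithin 2 f (Icc (x 0) (x n)) (x 0)
      - (derivative (derivative (quartic x f 0))).eval (x 0)| ≤
      5 / 6 * meshSize n x ^ 3 * derivNorm 5 f (x 0) (x 4) := by
  have h04 := knot_lt hx (show 0 < 4 by omega) hn
  rw [← iteratedDerivWithin_Icc_subset h04 le_rfl (knot_le hx hn le_rfl)
    (hf.of_le (by norm_num)) (left_mem_Icc.2 h04.le)]
  exact (endNodes_left hn hx le_rfl).second_error_five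
    (derivChain_iteratedDerivWithin h04 hf5) h04.le (quartic_natDegree_le hx (by omega))
    (fun j hj => by
      rw [quartic_eval hx (by omega) (by omega) (by omega), iteratedDerivWithin_zero])
    (fun t ht => abs_le_derivNorm h04 hf5 ht)

theorem second_error_right_five (hn : 4 ≤ n) (hx : ∀ i < n, x i < x (i + 1))
    (hf : ContDiffOn ℝ 4 f (Icc (x 0) (x n))) (hf5 : ContDiffOn ℝ 5 f (Icc (x (n - 4)) (x n))) :
    |iteratedDerivWithin 2 f (Icc (x 0) (x n)) (x n)
      - (derivative (derivative (quartic x f (n - 4)))).eval (x n)| ≤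
      5 / 6 * meshSize n x ^ 3 * derivNorm 5 f (x (n - 4)) (x n) := by
  have h4n := knot_lt hx (show n - 4 < n by omega) le_rfl
  rw [← iteratedDerivWithin_Icc_subset h4n (knot_le hx (by omega) (by omega)) le_rfl
    (hf.of_le (by norm_num)) (right_mem_Icc.2 h4n.le)]
  exact (endNodes_right hn hx le_rfl).second_error_five
    (derivChain_iteratedDerivWithin h4n hf5) h4n.le (quartic_natDegree_le hx (by omega))
    (fun j hj => by
      rw [quartic_eval hx (by omega) (by omega) (by omega), iteratedDerivWithin_zero])
    (fun t ht => abs_le_derivNorm h4n hf5 ht)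

/-- A number bounded in terms of `f⁽⁴⁾` and, where it exists, `f⁽⁵⁾`, is bounded in terms of
`ratioR`. -/
theorem le_ratioR {δ : ℝ} (hh : 0 < meshSize n x) (hF : 0 ≤ derivNorm 4 f (x 0) (x n))
    (h4 : δ ≤ 11 / 6 * meshSize n x ^ 2 * derivNorm 4 f (x 0) (x n))
    (h5 : ContDiffOn ℝ 5 f (Icc (x 0) (x 4)) → ContDiffOn ℝ 5 f (Icc (x (n - 4)) (x n)) →
      δ ≤ 5 / 6 * meshSize n x ^ 3 *
        max (derivNorm 5 f (x 0) (x 4)) (derivNorm 5 f (x (n - 4)) (x n))) :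
    δ ≤ 2 * ratioR n x f * meshSize n x ^ 2 * derivNorm 4 f (x 0) (x n) := by
  rcases hF.eq_or_lt with hF0 | hF0
  · rw [← hF0] at h4 ⊢
    linarith
  set F := derivNorm 4 f (x 0) (x n) with hFdef
  set h := meshSize n x with hhdef
  -- The bound `h4` is twice as good as needed; the factor `2` is dictated by the other branch,
  -- where `5 / 6 = 2 * (5 / 12)`.
  have h4' : δ ≤ 2 * (11 / 6) * h ^ 2 * F := h4.trans (by gcongr; norm_num)
  have hden0 : 12 * ENNReal.ofReal F ≠ 0 := by simp [hF0]
  have hdenT : 12 * ENNReal.ofReal F ≠ ⊤ := ENNReal.mul_ne_top (by norm_num) ENNReal.ofReal_ne_top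
  have h116 : ((11 / 6 : ℝ≥0∞)).toReal = 11 / 6 := by simp
  unfold ratioR fifthNorm
  rw [← hhdef, ← hFdef]
  split_ifs with hC
  · have h5' := h5 hC.1 hC.2
    set G := max (derivNorm 5 f (x 0) (x 4)) (derivNorm 5 f (x (n - 4)) (x n))
    rw [ENNReal.toReal_min (by finiteness)
      (ENNReal.div_ne_top (by finiteness) hden0), h116]
    simp only [ENNReal.toReal_div, ENNReal.toReal_mul, ENNReal.toReal_ofReal hh.le,
      ENNReal.toReal_ofReal hF0.le, ENNReal.toReal_ofReal', ENNReal.toReal_ofNat]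
    rcases min_choice (11 / 6 : ℝ) (5 * h * max G 0 / (12 * F)) with hm | hm <;> rw [hm]
    · exact h4'
    · calc δ ≤ 5 / 6 * h ^ 3 * G := h5'
        _ ≤ 5 / 6 * h ^ 3 * max G 0 := by gcongr; exact le_max_left _ _
        _ = _ := by field_simp; ring
  · have : 5 * ENNReal.ofReal h * ⊤ / (12 * ENNReal.ofReal F) = ⊤ := by
      rw [ENNReal.mul_top (by simp [hh]), ENNReal.top_div_of_ne_top hdenT]
    rw [this, min_eq_left le_top, h116]
    exact h4'

theorem IsQSpline.isCubicPiece {s : ℝ → ℝ} (hx : ∀ i < n, x i < x (i + 1))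
    (hs : IsQSpline n x f s) {i : ℕ} (hi : i < n) {q : ℝ[X]} (hq : q.natDegree ≤ 3)
    (hqs : ∀ t ∈ Icc (x i) (x (i + 1)), s t = q.eval t) :
    IsCubicPiece q (fun k => iteratedDerivWithin k f (Icc (x 0) (x n)))
      (iteratedDerivWithin 1 s (Icc (x 0) (x n))) (iteratedDerivWithin 2 s (Icc (x 0) (x n)))
      (x i) (x (i + 1)) := by
  have hlt := hx i hi
  have hl : x i ∈ Icc (x i) (x (i + 1)) := left_mem_Icc.2 hlt.le
  have hr : x (i + 1) ∈ Icc (x i) (x (i + 1)) := right_mem_Icc.2 hlt.le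
  have hs2 := hs.isCubicSpline.contDiffOn
  have key : ∀ k : ℕ, k ≤ 2 → ∀ t ∈ Icc (x i) (x (i + 1)),
      (derivative^[k] q).eval t = iteratedDerivWithin k s (Icc (x 0) (x n)) t := by
    intro k hk t ht
    rw [← iteratedDerivWithin_eval q hlt k ht,
      ← iteratedDerivWithin_Icc_subset hlt (knot_le hx (by omega) (by omega))
        (knot_le hx (by omega) le_rfl) (hs2.of_le (by exact_mod_cast hk)) ht]
    exact (iteratedDerivWithin_congr hqs ht).symm
  refine ⟨hq, ?_, ?_, key 1 (by omega) _ hl, key 1 (by omega) _ hr, key 2 le_rfl _ hl,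
    key 2 le_rfl _ hr⟩
  · rw [iteratedDerivWithin_zero, ← hqs _ hl, hs.interpolates i hi.le]
  · rw [iteratedDerivWithin_zero, ← hqs _ hr, hs.interpolates (i + 1) hi]

end Knots

end QSpline

/-! ### The error bound -/

theorem theorem2 (n : ℕ) (hn : 4 ≤ n) (x : ℕ → ℝ) (hx : ∀ i < n, x i < x (i + 1))
    (f : ℝ → ℝ) (hf : ContDiffOn ℝ 4 f (Set.Icc (x 0) (x n)))
    (s : ℝ → ℝ) (hs : QSpline.IsQSpline n x f s) :
    ∀ t ∈ Set.Icc (x 0) (x n),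
      |s t - f t| ≤ (5 / 384 + QSpline.ratioR n x f / 8) *
        QSpline.derivNorm 4 f (x 0) (x n) * QSpline.meshSize n x ^ 4 := by
  open QSpline in
  intro t ht
  have h0n := knot_lt hx (show 0 < n by omega) le_rfl
  have hh : 0 < meshSize n x := (sub_pos.2 (hx 0 (by omega))).trans_le
    (step_le_meshSize (by omega))
  have hF : 0 ≤ derivNorm 4 f (x 0) (x n) :=
    (abs_nonneg _).trans (abs_le_derivNorm h0n hf (left_mem_Icc.2 h0n.le))
  have hleft := le_ratioR hh hF (second_error_left_four hn hx hf) fun h1 _ =>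
    (second_error_left_five hn hx hf h1).trans (by gcongr; exact le_max_left _ _)
  have hright := le_ratioR hh hF (second_error_right_four hn hx hf) fun _ h2 =>
    (second_error_right_five hn hx hf h2).trans (by gcongr; exact le_max_right _ _)
  rw [← hs.left_end] at hleft
  rw [← hs.right_end] at hright
  choose! q hq hqs using hs.isCubicSpline.cubic
  obtain ⟨i, hi, hti⟩ := exists_mem_step (by omega) ht
  have hsub : ∀ i < n, Icc (x i) (x (i + 1)) ⊆ Icc (x 0) (x n) := fun i hi =>
    Icc_subset_Icc (knot_le hx (by omega) (by omega)) (knot_le hx (by omega) le_rfl)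
  have key := spline_bound hn hx (fun i hi => step_le_meshSize hi)
    (fun i hi => (derivChain_iteratedDerivWithin h0n hf).mono
      (knot_le hx (by omega) (by omega)) (knot_le hx (by omega) le_rfl))
    (fun i hi t ht => abs_le_derivNorm h0n hf (hsub i hi ht))
    (fun i hi => hs.isCubicPiece hx hi (hq i hi) (hqs i hi)) hleft hright hi hti
  rw [iteratedDerivWithin_zero, ← hqs i hi t hti, abs_sub_comm] at key
  refine key.trans (le_of_eq ?_)
  ring
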